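/- Let $\Bbbk$ be a field of arbitrary characteristic. An operad here is a symmetric operad $\mathcal P=(\mathcal P(n))_{n\ge 0}$ over $\Bbbk$ with partial compositions $\circ_i$ and right actions $*$ of the symmetric groups $\mathbb S_n$, which is reduced ($\mathcal P(0)=0$) and locally finite ($\dim_\Bbbk \mathcal P(n)<\infty$ for all $n$). It is *infinite dimensional* if $\bigoplus_n\mathcal P(n)$ is; it is *prime* if for any nonzero (two-sided) ideals $I,J$ of $\mathcal P$ the $\mathbb S$-submodule $I\circ J$ generated by all $x\circ_i y$ ($x\in I$, $y\in J$) is nonzero; it is *almost $\mathbb A$-trivial* if, for all $n\gg 0$, $\lambda*\sigma=\lambda$ for all $\lambda\in\mathcal P(n)$ and all $\sigma$ in the alternating group $\mathbb A_n$. A *pseudo-graded-commutative* (PGC) algebra is a unital, locally finite, $\mathbb N$-graded associative $\Bbbk$-algebra $A=\bigoplus_{i\ge0}A_i$ with decompositions $A_i=A_{i,e}\oplus A_{i,o}$ for $i\ge1$, such that $A_e=\bigoplus_{i\ge1}A_{i,e}$ and $A_o=\bigoplus_{i\ge1}A_{i,o}$ are two-sided ideals of $A$ and $yz=(-1)^{\deg(y)\deg(z)t(y)t(z)}zy$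 for all homogeneous $y,z$, that is, elements of $A_0$, $A_{i,e}$ or $A_{i,o}$; here $t=1$ on each $A_{i,o}$ and $t=0$ on $A_0$ and on each $A_{i,e}$. Let $\Xi$ be the map on $A_1$ that is $+1$ on $A_{1,e}$ and $-1$ on $A_{1,o}$. The operad $G_{\mathbb A\text{-triv}}(A)$ has $\mathcal P(0)=0$, $\mathcal P(n)=A_{n-1}$ for $n\ge1$, identity $1_A$, and, for $n\ge 2$, the action $x*\sigma=x$ for $x\in A_{n-1,e}$ and $x*\sigma=\mathrm{sgn}(\sigma)x$ for $x\in A_{n-1,o}$. For homogeneous $x,y$ of arities $m,n\ge 1$ its partial compositions are as follows. * If $m=1$: $x\circ_1y=xy$. * If $m=2$: $x\circ_1 y=xy$, while $x\circ_2y=((x*\Xi)y)*\Xi$ when $n=1$ and $x\circ_2y=(-1)^{n\,t(y)}(x*\Xi)y$ when $n\ge2$. * If $m\ge3$: $x\circ_iy=(-1)^{(n-1)(i-1)t(x)}xy$ for $1\le i\le m$. **Statement.** Let $\mathcal P$ be an infinite dimensional prime almost $\mathbb A$-trivial operad. Then $\mathcal P\cong G_{\mathbb A\text{-triv}}(A)$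 as operads for some PGC algebra $A$ that is commutative (that is, $ab=ba$ for all $a,b\in A$). Moreover every $\mu\in\mathcal P(m)$, $m\geq 1$, is central: for every $n\ge1$, every $\nu\in\mathcal P(n)$ and all $1\le i\le m$, $1\le j\le n$, $$\mu\circ_i\nu=\nu\circ_j\mu .$$ -/

import Mathlib

universe u v

open scoped DirectSum

/-- The inputs of `μ ∘ᵢ ν`, for `μ` of arity `m` and `ν` of arity `n`, are the inputs of `μ`
other than the `i`-th one together with the inputs of `ν`. In the order of `Fin r`, `r = m+n-1`,
the inputs of `ν` form the block `i, …, i+n-1`, and the inputs of `μ` after the `i`-th one are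
shifted by `n-1`. Positions are counted from `0`. -/
def insertFun {m n r : ℕ} (h : r + 1 = m + n) (i : Fin m) :
    {j : Fin m // j ≠ i} ⊕ Fin n → Fin r
  | Sum.inl j =>
      if hj : (j.1 : ℕ) < i then ⟨j.1, by omega⟩
      else ⟨j.1 + n - 1, by
        have h1 := j.1.2
        have h2 : (j.1 : ℕ) ≠ i := fun e => j.2 (Fin.ext e)
        omega⟩
  | Sum.inr q => ⟨i + q, by omega⟩

theorem insertFun_bijective {m n r : ℕ} (h : r + 1 = m + n) (i : Fin m) :
    Function.Bijective (insertFun h i) := by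
  rw [Fintype.bijective_iff_injective_and_card]
  constructor
  · rintro (⟨a, ha⟩ | a) (⟨b, hb⟩ | b) hab
    · have ha' : (a : ℕ) ≠ i := fun e => ha (Fin.ext e)
      have hb' : (b : ℕ) ≠ i := fun e => hb (Fin.ext e)
      have : (a : ℕ) = b := by
        simp only [insertFun] at hab
        split_ifs at hab <;> simp only [Fin.mk.injEq] at hab <;> omega
      simp [Fin.ext_iff, this]
    · have ha' : (a : ℕ) ≠ i := fun e => ha (Fin.ext e)
      exfalso
      simp only [insertFun] at hab
      split_ifs at hab <;> simp only [Fin.mk.injEq] at hab <;> omega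
    · have hb' : (b : ℕ) ≠ i := fun e => hb (Fin.ext e)
      exfalso
      simp only [insertFun] at hab
      split_ifs at hab <;> simp only [Fin.mk.injEq] at hab <;> omega
    · simp only [insertFun, Fin.mk.injEq] at hab
      have : (a : ℕ) = b := by omega
      simp [Fin.ext_iff, this]
  · have h1 : Fintype.card {j : Fin m // j ≠ i} = m - 1 := by
      simp
    have := i.2
    rw [Fintype.card_sum, h1, Fintype.card_fin, Fintype.card_fin]
    omega

noncomputable section

def insertEquiv {m n r : ℕ} (h : r + 1 = m + n) (i : Fin m) :
    {j : Fin m // j ≠ i} ⊕ Fin n ≃ Fin r :=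
  Equiv.ofBijective (insertFun h i) (insertFun_bijective h i)

/-- The block permutation `σ'`: it acts by `σ` on the block of inputs of `ν` in `μ ∘ᵢ ν` and
fixes all the other inputs. -/
def innerPerm {m n r : ℕ} (h : r + 1 = m + n) (i : Fin m) (σ : Equiv.Perm (Fin n)) :
    Equiv.Perm (Fin r) :=
  (insertEquiv h i).symm.trans
    ((Equiv.sumCongr (Equiv.refl _) σ).trans (insertEquiv h i))

/-- The block permutation `φ''`: it permutes by `φ` the `m` blocks of inputs, the `i`-th of
which has size `n` while the others have size `1`, keeping the order inside each block. -/
def outerPerm {m n r : ℕ} (h : r + 1 = m + n) (i : Fin m) (φ : Equiv.Perm (Fin m)) :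
    Equiv.Perm (Fin r) :=
  (insertEquiv h i).symm.trans
    ((Equiv.sumCongr
      (φ.subtypeEquiv (p := fun j => j ≠ i) (q := fun j => j ≠ φ i) (fun _ => by simp))
      (Equiv.refl (Fin n))).trans (insertEquiv h (φ i)))

/-- The data of a symmetric operad over `k`: the spaces `P(n)` of `n`-ary operations, the maps
`x ↦ x ∗ σ`, the identity, and the partial compositions
`∘ᵢ : P(m) ⊗ P(n) → P(r)` with `r = m + n - 1`. Positions `i` are counted from `0`. -/
structure OperadData (k : Type u) [Field k] where
  Op : ℕ → Type v
  [addCommGroup : ∀ n, AddCommGroup (Op n)]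
  [module : ∀ n, Module k (Op n)]
  act : ∀ {n : ℕ}, Equiv.Perm (Fin n) → Op n →ₗ[k] Op n
  one : Op 1
  comp : ∀ {m n r : ℕ}, r + 1 = m + n → Fin m → Op m →ₗ[k] Op n →ₗ[k] Op r

attribute [instance] OperadData.addCommGroup OperadData.module

/-- A symmetric operad over `k` (partial definition). -/
structure SymOperad (k : Type u) [Field k] extends OperadData.{u, v} k where
  /-- each `P(n)` is a right module over the symmetric group -/
  act_one : ∀ {n : ℕ} (x : Op n), act 1 x = x
  act_mul : ∀ {n : ℕ} (σ τ : Equiv.Perm (Fin n)) (x : Op n), act (σ * τ) x = act τ (act σ x)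
  /-- unit axioms -/
  comp_one : ∀ {n : ℕ} (i : Fin n) (x : Op n), comp rfl i x one = x
  one_comp : ∀ {n : ℕ} (x : Op n), comp (Nat.add_comm n 1) 0 one x = x
  /-- sequential composition: `(x ∘ᵢ y) ∘_{i-1+j} z = x ∘ᵢ (y ∘ⱼ z)`, positions from `1` -/
  comp_assoc : ∀ {l m n a b r : ℕ} (ha : a + 1 = l + m) (hr : r + 1 = a + n)
    (hb : b + 1 = m + n) (hr' : r + 1 = l + b) (i : Fin l) (j : Fin m) (p : Fin a),
    (p : ℕ) = i + j → ∀ (x : Op l) (y : Op m) (z : Op n),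
    comp hr p (comp ha i x y) z = comp hr' i x (comp hb j y z)
  /-- parallel composition: `(x ∘ᵢ y) ∘_{q-1+m} z = (x ∘_q z) ∘ᵢ y` for `i < q`, positions
  from `1` -/
  comp_comm : ∀ {l m n a b r : ℕ} (ha : a + 1 = l + m) (hr : r + 1 = a + n)
    (hb : b + 1 = l + n) (hr' : r + 1 = b + m) (i q : Fin l) (p : Fin a) (i' : Fin b),
    i < q → (p : ℕ) + 1 = q + m → (i' : ℕ) = i → ∀ (x : Op l) (y : Op m) (z : Op n),
    comp hr p (comp ha i x y) z = comp hr' i' (comp hb q x z) y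
  /-- equivariance -/
  comp_act : ∀ {m n r : ℕ} (h : r + 1 = m + n) (i : Fin m) (x : Op m)
    (σ : Equiv.Perm (Fin n)) (y : Op n),
    comp h i x (act σ y) = act (innerPerm h i σ) (comp h i x y)
  act_comp : ∀ {m n r : ℕ} (h : r + 1 = m + n) (i : Fin m) (φ : Equiv.Perm (Fin m))
    (x : Op m) (y : Op n),
    comp h i (act φ x) y = act (outerPerm h i φ) (comp h (φ i) x y)

namespace OperadData

variable {k : Type u} [Field k]

/-- An isomorphism of operads. -/
structure Iso (P Q : OperadData.{u, v} k) where
  map : ∀ n : ℕ, P.Op n ≃ₗ[k] Q.Op n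
  map_act : ∀ {n : ℕ} (σ : Equiv.Perm (Fin n)) (x : P.Op n),
    map n (P.act σ x) = Q.act σ (map n x)
  map_one : map 1 P.one = Q.one
  map_comp : ∀ {m n r : ℕ} (h : r + 1 = m + n) (i : Fin m) (x : P.Op m) (y : P.Op n),
    map r (P.comp h i x y) = Q.comp h i (map m x) (map n y)

def IsReduced (P : OperadData.{u, v} k) : Prop := Subsingleton (P.Op 0)

def IsLocallyFinite (P : OperadData.{u, v} k) : Prop := ∀ n, FiniteDimensional k (P.Op n)

def IsInfiniteDimensional (P : OperadData.{u, v} k) : Prop :=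
  ¬ FiniteDimensional k (⨁ n, P.Op n)

/-- The elements of `P(n)` are fixed by the alternating group, for all large `n`. -/
def IsAlmostATrivial (P : OperadData.{u, v} k) : Prop :=
  ∃ N : ℕ, ∀ n, N ≤ n → ∀ x : P.Op n, ∀ σ ∈ alternatingGroup (Fin n), P.act σ x = x

/-- A two-sided ideal of an operad. -/
structure OpIdeal (P : OperadData.{u, v} k) where
  carrier : ∀ n, Submodule k (P.Op n)
  act_mem : ∀ {n : ℕ} (σ : Equiv.Perm (Fin n)) (x : P.Op n),
    x ∈ carrier n → P.act σ x ∈ carrier n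
  comp_mem_left : ∀ {m n r : ℕ} (h : r + 1 = m + n) (i : Fin m) (x : P.Op m) (y : P.Op n),
    x ∈ carrier m → P.comp h i x y ∈ carrier r
  comp_mem_right : ∀ {m n r : ℕ} (h : r + 1 = m + n) (i : Fin m) (x : P.Op m) (y : P.Op n),
    y ∈ carrier n → P.comp h i x y ∈ carrier r

/-- `I ∘ J`: the submodule, stable under the symmetric groups, that is generated by all `x ∘ᵢ y`
with `x` in `I` and `y` in `J`. -/
def OpIdeal.circ {P : OperadData.{u, v} k} (I J : OpIdeal P) (r : ℕ) : Submodule k (P.Op r) :=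
  Submodule.span k {z | ∃ (m n : ℕ) (h : r + 1 = m + n) (i : Fin m) (x : P.Op m) (y : P.Op n)
    (σ : Equiv.Perm (Fin r)), x ∈ I.carrier m ∧ y ∈ J.carrier n ∧ z = P.act σ (P.comp h i x y)}

def IsPrime (P : OperadData.{u, v} k) : Prop :=
  ∀ I J : OpIdeal P, (∃ n, I.carrier n ≠ ⊥) → (∃ n, J.carrier n ≠ ⊥) → ∃ r, I.circ J r ≠ ⊥

/-- `μ ∈ P(m)` is central: `μ ∘ᵢ ν = ν ∘ⱼ μ` for all `ν` and all positions `i`, `j`. -/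
def IsCentral (P : OperadData.{u, v} k) {m : ℕ} (μ : P.Op m) : Prop :=
  ∀ {n r : ℕ} (h : r + 1 = m + n) (h' : r + 1 = n + m) (ν : P.Op n) (i : Fin m) (j : Fin n),
    P.comp h i μ ν = P.comp h' j ν μ

end OperadData

/-- A unital, locally finite, `ℕ`-graded associative algebra `A` with a decomposition
`A_i = A_{i,e} ⊕ A_{i,o}` in every degree `i ≥ 1`. The elements of degree `0` have type `0` like
the even ones, which is recorded by `A_{0,e} = A_0` and `A_{0,o} = 0`. -/
structure TypedGradedAlgebra (k : Type u) [Field k] where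
  carrier : Type v
  [ring : Ring carrier]
  [algebra : Algebra k carrier]
  grading : ℕ → Submodule k carrier
  [graded : GradedAlgebra grading]
  locallyFinite : ∀ i, FiniteDimensional k (grading i)
  even : ∀ i, Submodule k (grading i)
  odd : ∀ i, Submodule k (grading i)
  isCompl : ∀ i, IsCompl (even i) (odd i)
  even_zero : even 0 = ⊤
  odd_zero : odd 0 = ⊥

attribute [instance] TypedGradedAlgebra.ring TypedGradedAlgebra.algebra
  TypedGradedAlgebra.graded

namespace TypedGradedAlgebra

variable {k : Type u} [Field k] (A : TypedGradedAlgebra.{u, v} k)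

def IsCommutative : Prop := ∀ a b : A.carrier, a * b = b * a

/-- The homogeneous elements of degree `i` and type `t(x) = t`: even ones for `t = 0`, odd ones
for `t = 1`. -/
def part (i : ℕ) (t : Fin 2) : Submodule k (A.grading i) := if t = 0 then A.even i else A.odd i

/-- `A_e` (for `t = 0`) and `A_o` (for `t = 1`): the sum over all degrees `i ≥ 1`. -/
def positivePart (t : Fin 2) : Submodule k A.carrier :=
  ⨆ (i : ℕ) (_ : 1 ≤ i), (A.part i t).map (A.grading i).subtype

/-- Pseudo-graded-commutative (PGC) algebras: `A_e` and `A_o` are two-sided ideals, and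
`y z = (-1)^(deg y * deg z * t(y) * t(z)) z y` for homogeneous `y`, `z`. -/
structure IsPGC : Prop where
  mul_mem_left : ∀ (t : Fin 2) (a x : A.carrier), x ∈ A.positivePart t → a * x ∈ A.positivePart t
  mul_mem_right : ∀ (t : Fin 2) (a x : A.carrier), x ∈ A.positivePart t → x * a ∈ A.positivePart t
  mul_comm : ∀ (i j : ℕ) (s t : Fin 2) (y : A.grading i) (z : A.grading j),
    y ∈ A.part i s → z ∈ A.part j t →
    (y : A.carrier) * z = (-1) ^ (i * j * (s : ℕ) * (t : ℕ)) * (z * y)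

/-- `x ↦ x_e + c x_o` on `A_i`. For `c = -1` and `i = 1` this is the map `x ↦ x ∗ Ξ`. -/
def twist (c : k) (i : ℕ) : A.grading i →ₗ[k] A.grading i :=
  Submodule.projection _ _ (A.isCompl i) + c • Submodule.projection _ _ (A.isCompl i).symm

/-- The multiplication `A_i × A_j → A_{i+j}`. -/
def gmul {i j r : ℕ} (h : i + j = r) : A.grading i →ₗ[k] A.grading j →ₗ[k] A.grading r :=
  LinearMap.mk₂ k
    (fun x y => ⟨(x : A.carrier) * y, h ▸ SetLike.mul_mem_graded x.2 y.2⟩)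
    (fun _ _ _ => Subtype.ext (add_mul _ _ _))
    (fun _ _ _ => Subtype.ext (smul_mul_assoc _ _ _))
    (fun _ _ _ => Subtype.ext (mul_add _ _ _))
    (fun _ _ _ => Subtype.ext (mul_smul_comm _ _ _))

/-- The space of `n`-ary operations of `G(A)`: `0` for `n = 0`, and `A_{n-1}` for `n ≥ 1`. -/
def opSpace : ℕ → Submodule k A.carrier
  | 0 => ⊥
  | n + 1 => A.grading n

/-- Partial compositions of `x` of arity `m + 1` with `y` of arity `n + 1` at the position
`i + 1`, given on homogeneous `x`, `y` by
* `x ∘ y = x y` if `x` has arity `1`;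
* `x ∘₁ y = x y`, and `x ∘₂ y = ((x ∗ Ξ) y) ∗ Ξ` or `(-1)^(Ar(y) t(y)) (x ∗ Ξ) y` according as
  `y` has arity `1` or `≥ 2`, if `x` has arity `2`;
* `x ∘_{i+1} y = (-1)^((Ar(y)-1) i t(x)) x y` if `x` has arity at least `3`. -/
def opComp {m n r : ℕ} (h : m + n = r) (i : Fin (m + 1)) :
    A.grading m →ₗ[k] A.grading n →ₗ[k] A.grading r :=
  if m = 0 then A.gmul h
  else if m = 1 then
    if (i : ℕ) = 0 then A.gmul h
    else if n = 0 then ((A.gmul h).comp (A.twist (-1) m)).compr₂ (A.twist (-1) r)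
    else (A.gmul h).compl₁₂ (A.twist (-1) m) (A.twist ((-1) ^ (n + 1)) n)
  else (A.gmul h).comp (A.twist ((-1) ^ (n * (i : ℕ))) m)

/-- The operad `G(A)` associated to a PGC algebra `A`, with `G(A)(n) = A_{n-1}` for `n ≥ 1`: the
symmetric groups act trivially on even elements and on `A_0`, and by the sign on odd elements. -/
def toOperad : OperadData.{u, v} k where
  Op n := A.opSpace n
  act {n} σ := match n, σ with
    | 0, _ => LinearMap.id
    | n + 1, σ => A.twist (((Equiv.Perm.sign σ : ℤˣ) : ℤ) : k) n
  one := ⟨1, SetLike.one_mem_graded A.grading⟩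
  comp {m n r} h i := match m, n, r, h, i with
    | 0, _, _, _, i => i.elim0
    | _ + 1, 0, _, _, _ => 0
    | _ + 1, _ + 1, 0, h, _ => absurd h (by omega)
    | _ + 1, _ + 1, _ + 1, h, i => A.opComp (by omega) i

end TypedGradedAlgebra

end

/-! In large arity all odd permutations act by a single involution ρ that is compatible with
compositions. The differences y∗σ - y and y∗σ + y (σ odd) therefore generate ideals whose product
lies in the image of (ρ-1)(ρ+1) = ρ²-1 = 0, and primality kills one of them. So odd permutations act
by a common scalar ε = χ(-1) = ±1. This descends to every arity because an operation annihilated by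
all x ∘ᵢ - with x of large arity is zero (`eq_zero_of_comp_eq_zero`); here infinite dimensionality
enters.

Exchanging adjacent blocks of sizes n and 1 is a cycle of sign (-1)^n, so equivariance gives x
∘_{i+1} y = ε^(n+1) x ∘ᵢ y (`comp_eq_pow_smul_comp_zero`). Comparing sequential with parallel
composition under an x of arity at least 2 then gives y ∘₁ z = ε^((n+1)(p+1)) z ∘₁ y, where n, p are
the arities of y, z (`comp_zero_comm`).

If ε = -1 ≠ 1, an operation of even arity has square zero, hence vanishes by primality
(`eq_zero_of_comp_self_eq_zero`). All arities that survive are odd, where the signs above are 1.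
Thus every operation is central in all cases. The algebra ⨁ P(n+1) with product ∘₁ is then
commutative; declaring its positive part wholly even or wholly odd, according to the action,
recovers P. -/

/-! ### Signs of block permutations -/

theorem sign_innerPerm {m n r : ℕ} (h : r + 1 = m + n) (i : Fin m) (σ : Equiv.Perm (Fin n)) :
    Equiv.Perm.sign (innerPerm h i σ) = Equiv.Perm.sign σ := by
  rw [← one_mul (Equiv.Perm.sign σ), ← Equiv.Perm.sign_one (α := {j : Fin m // j ≠ i}),
    ← Equiv.Perm.sign_sumCongr]
  exact Equiv.Perm.sign_symm_trans_trans (Equiv.Perm.sumCongr 1 σ) (insertEquiv h i)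

theorem outerPerm_inl {m n r : ℕ} (h : r + 1 = m + n) (i : Fin m) (φ : Equiv.Perm (Fin m))
    (j : {j : Fin m // j ≠ i}) :
    outerPerm h i φ (insertFun h i (Sum.inl j)) =
      insertFun h (φ i) (Sum.inl ⟨φ j, fun e => j.2 (φ.injective e)⟩) := by
  change outerPerm h i φ (insertEquiv h i (Sum.inl j)) = _
  simp only [outerPerm, Equiv.trans_apply, Equiv.symm_apply_apply]
  rfl

theorem outerPerm_inr {m n r : ℕ} (h : r + 1 = m + n) (i : Fin m) (φ : Equiv.Perm (Fin m))
    (q : Fin n) :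
    outerPerm h i φ (insertFun h i (Sum.inr q)) = insertFun h (φ i) (Sum.inr q) := by
  change outerPerm h i φ (insertEquiv h i (Sum.inr q)) = _
  simp only [outerPerm, Equiv.trans_apply, Equiv.symm_apply_apply]
  rfl

/-- The big block stays in place, so the block permutation is conjugate to the sum of φ restricted
to the other positions and the identity. -/
theorem sign_outerPerm_of_fixed {m n r : ℕ} (h : r + 1 = m + n) (i : Fin m)
    (φ : Equiv.Perm (Fin m)) (hφ : φ i = i) :
    Equiv.Perm.sign (outerPerm h i φ) = Equiv.Perm.sign φ := by
  have hp : ∀ j, φ j ≠ i ↔ j ≠ i := fun j =>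
    not_congr ⟨fun e => φ.injective (e.trans hφ.symm), fun e => e ▸ hφ⟩
  rw [← Equiv.Perm.sign_subtypePerm (p := fun j => j ≠ i) φ hp (fun j hj (e : j = i) => hj (e ▸ hφ)),
    ← mul_one (Equiv.Perm.sign (φ.subtypePerm hp)), ← Equiv.Perm.sign_one (α := Fin n),
    ← Equiv.Perm.sign_sumCongr]
  refine (Equiv.Perm.sign_eq_sign_of_equiv _ _ (insertEquiv h i) ?_).symm
  have key : ∀ (i' : Fin m) (_ : i' = i) (a : Fin m) (ha : a ≠ i) (ha' : a ≠ i'),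
      insertFun h i (Sum.inl ⟨a, ha⟩) = insertFun h i' (Sum.inl ⟨a, ha'⟩) := by
    rintro _ rfl a _ _; rfl
  rintro (j | q)
  · refine Eq.trans ?_ (outerPerm_inl h i φ j).symm
    exact key _ hφ _ _ _
  · refine Eq.trans ?_ (outerPerm_inr h i φ q).symm
    rw [hφ]; rfl

theorem sign_outerPerm_swap {m n r : ℕ} (h : r + 1 = m + n) (i i' : Fin m)
    (hi : (i' : ℕ) = i + 1) :
    Equiv.Perm.sign (outerPerm h i (Equiv.swap i i')) = (-1) ^ n := by
  have hi' := i'.2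
  have hr : 0 < r := by omega
  have : NeZero r := ⟨hr.ne'⟩
  let a : Fin r := ⟨i, by omega⟩
  let b : Fin r := ⟨i + n, by omega⟩
  have hab : a ≤ b := Fin.le_def.2 (by simp [a, b])
  -- The block of size n moves up by one and the single input after it jumps to the front: a cycle
  -- of length n+1.
  have key : outerPerm h i (Equiv.swap i i') = Fin.cycleIcc a b := by
    ext x
    obtain ⟨z, rfl⟩ := (insertEquiv h i).surjective x
    change ((outerPerm h i (Equiv.swap i i') (insertFun h i z) : Fin r) : ℕ) =
      (Fin.cycleIcc a b (insertFun h i z) : Fin r)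
    rcases z with ⟨j, hj⟩ | q
    · rw [outerPerm_inl]
      have hne : (j : ℕ) ≠ i := fun e => hj (Fin.ext e)
      by_cases hji : j = i'
      · subst hji
        have : insertFun h i (Sum.inl ⟨j, hj⟩) = b := by
          simp only [insertFun, b]
          split_ifs <;> simp only [Fin.mk.injEq] <;> omega
        rw [this, Fin.cycleIcc_of_last hab]
        simp only [insertFun, a, Equiv.swap_apply_right, Equiv.swap_apply_left]
        rw [dif_pos (by omega)]
      · have hne' : (j : ℕ) ≠ i' := fun e => hji (Fin.ext e)
        simp only [insertFun, Equiv.swap_apply_left, Equiv.swap_apply_of_ne_of_ne hj hji]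
        by_cases hlt : (j : ℕ) < i
        · rw [dif_pos (by omega), dif_pos hlt, Fin.cycleIcc_of_lt (by simp [Fin.lt_def, a, hlt])]
        · rw [dif_neg (by omega), dif_neg hlt, Fin.cycleIcc_of_gt (by
            simp only [Fin.lt_def, b]; omega)]
    · rw [outerPerm_inr]
      have hq := q.2
      rw [Fin.cycleIcc_of_ge_of_lt (by simp [Fin.le_def, a, insertFun])
        (by simp only [Fin.lt_def, b, insertFun]; omega)]
      rw [Fin.val_add_one_of_lt' (by simp only [insertFun]; omega)]
      simp only [insertFun, Equiv.swap_apply_left]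
      omega
  rw [key, Fin.sign_cycleIcc_of_le hab]
  simp [a, b]

/-! ### Primality, truncations and the alternating action -/

namespace OperadData

variable {k : Type u} [Field k] {P : OperadData.{u, v} k}

theorem IsPrime.eq_bot_or_eq_bot (hprime : P.IsPrime) (I J : OpIdeal P)
    (h : ∀ {m n r : ℕ} (h : r + 1 = m + n) (i : Fin m) (x : P.Op m) (y : P.Op n),
      x ∈ I.carrier m → y ∈ J.carrier n → P.comp h i x y = 0) :
    (∀ n, I.carrier n = ⊥) ∨ (∀ n, J.carrier n = ⊥) := by
  by_contra hcon
  push Not at hcon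
  obtain ⟨r, hr⟩ := hprime I J hcon.1 hcon.2
  refine hr (Submodule.span_eq_bot.2 ?_)
  rintro z ⟨m, n, hr', i, x, y, σ, hx, hy, rfl⟩
  rw [h hr' i x y hx hy, map_zero]

/-- The ideal of all operations of arity at least `M`. -/
def IsReduced.truncation (hred : P.IsReduced) (M : ℕ) : OpIdeal P where
  carrier n := if M ≤ n then ⊤ else ⊥
  act_mem {n} σ x hx := by
    split_ifs at hx ⊢
    · trivial
    · rw [(Submodule.mem_bot k).1 hx, map_zero]; exact zero_mem _
  comp_mem_left {m n r} h i x y hx := by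
    rcases Nat.eq_zero_or_pos n with rfl | hn
    · rw [@Subsingleton.elim _ hred y 0, map_zero]; exact zero_mem _
    · by_cases hm : M ≤ m
      · rw [if_pos (by omega)]; trivial
      · rw [if_neg hm] at hx
        rw [(Submodule.mem_bot k).1 hx, map_zero, LinearMap.zero_apply]; exact zero_mem _
  comp_mem_right {m n r} h i x y hy := by
    have := i.2
    by_cases hn : M ≤ n
    · rw [if_pos (by omega)]; trivial
    · rw [if_neg hn] at hy
      rw [(Submodule.mem_bot k).1 hy, map_zero]; exact zero_mem _

theorem exists_nontrivial_of_isInfiniteDimensional (hfin : P.IsLocallyFinite)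
    (hinf : P.IsInfiniteDimensional) (M : ℕ) : ∃ n, M ≤ n ∧ Nontrivial (P.Op n) := by
  classical
  by_contra hcon
  push Not at hcon
  refine hinf ?_
  have : ∀ n, Module.Finite k (P.Op n) := hfin
  refine Module.Finite.of_surjective
    (∑ i : Fin M, (DirectSum.lof k ℕ P.Op i) ∘ₗ LinearMap.proj (φ := fun i : Fin M => P.Op i) i) ?_
  rw [← LinearMap.range_eq_top, eq_top_iff]
  rintro x -
  induction x using DirectSum.induction_on with
  | zero => exact zero_mem _
  | add x y hx hy => exact add_mem hx hy
  | of n x =>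
    by_cases hn : n < M
    · refine ⟨Pi.single (M := fun i : Fin M => P.Op i) ⟨n, hn⟩ x, ?_⟩
      rw [LinearMap.sum_apply, Finset.sum_eq_single ⟨n, hn⟩]
      · simp [DirectSum.lof_eq_of]
      · intro j _ hj
        simp [Pi.single_eq_of_ne hj]
      · simp
    · have := hcon n (not_lt.1 hn)
      rw [Subsingleton.elim x 0, map_zero]
      exact zero_mem _

/-- The quotient σ τ⁻¹ is even. This allows a block permutation to be replaced by any other of the
same parity. -/
theorem act_eq_of_sign_eq {P : SymOperad.{u, v} k} {n : ℕ}
    (h : ∀ x : P.Op n, ∀ σ ∈ alternatingGroup (Fin n), P.act σ x = x)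
    {σ τ : Equiv.Perm (Fin n)} (hs : Equiv.Perm.sign σ = Equiv.Perm.sign τ) (x : P.Op n) :
    P.act σ x = P.act τ x := by
  have h1 : σ = (σ * τ⁻¹) * τ := by group
  have h2 : σ * τ⁻¹ ∈ alternatingGroup (Fin n) := by
    rw [Equiv.Perm.mem_alternatingGroup, Equiv.Perm.sign_mul, Equiv.Perm.sign_inv, hs]
    exact Int.units_mul_self _
  rw [h1, P.act_mul, h x _ h2]

end OperadData

/-! ### Annihilators -/

namespace SymOperad

open Equiv.Perm

variable {k : Type u} [Field k] {P : SymOperad.{u, v} k}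

/-- The operations `y` with `x ∘ᵢ y = 0` for all `x` in the ideal `I`. -/
def rightAnnihilator (I : OperadData.OpIdeal P.toOperadData) :
    OperadData.OpIdeal P.toOperadData where
  carrier n :=
    { carrier := {y | ∀ (m r : ℕ) (h : r + 1 = m + n) (i : Fin m), ∀ x ∈ I.carrier m,
        P.comp h i x y = 0}
      add_mem' := fun {a b} ha hb m r h i x hm => by
        rw [map_add, ha m r h i x hm, hb m r h i x hm, add_zero]
      zero_mem' := fun m r h i x _ => map_zero _
      smul_mem' := fun c a ha m r h i x hm => by rw [map_smul, ha m r h i x hm, smul_zero] }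
  act_mem := fun σ y hy m r h i x hm => by rw [P.comp_act, hy m r h i x hm, map_zero]
  comp_mem_left := fun {m' n' r'} h' j y b hy m r h i x hm => by
    have := i.2
    have := j.2
    rw [← P.comp_assoc (a := m + m' - 1) (by omega) (by omega) h' h i j ⟨i + j, by omega⟩ rfl,
      hy m _ _ i x hm, map_zero, LinearMap.zero_apply]
  comp_mem_right := fun {m' n' r'} h' j a y hy m r h i x hm => by
    have := i.2
    have := j.2
    rw [← P.comp_assoc (a := m + m' - 1) (by omega) (by omega) h' h i j ⟨i + j, by omega⟩ rfl]
    exact hy _ _ _ _ _ (I.comp_mem_left _ _ _ _ hm)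

theorem eq_bot_or_rightAnnihilator_eq_bot (hprime : P.IsPrime)
    (I : OperadData.OpIdeal P.toOperadData) :
    (∀ n, I.carrier n = ⊥) ∨ ∀ n, (rightAnnihilator I).carrier n = ⊥ :=
  hprime.eq_bot_or_eq_bot I _ fun {m _ r} h i x _ hx hy => hy m r h i x hx

/-- An operation annihilated by all `x ∘ᵢ -`, `x` of large arity, is zero. -/
theorem eq_zero_of_comp_eq_zero (hred : P.IsReduced) (hfin : P.IsLocallyFinite)
    (hinf : P.IsInfiniteDimensional) (hprime : P.IsPrime) (M : ℕ) {n : ℕ} (y : P.Op n)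
    (hy : ∀ {m r : ℕ} (h : r + 1 = m + n) (i : Fin m) (x : P.Op m), M ≤ m →
      P.comp h i x y = 0) : y = 0 := by
  -- The truncation is nonzero by infinite dimensionality, so its right annihilator, which contains
  -- y, must vanish.
  rcases eq_bot_or_rightAnnihilator_eq_bot hprime (hred.truncation M) with h | h
  · obtain ⟨n, hn, hnt⟩ := OperadData.exists_nontrivial_of_isInfiniteDimensional hfin hinf M
    have := h n
    simp only [OperadData.IsReduced.truncation, if_pos hn] at this
    exact absurd this top_ne_bot
  · rw [← Submodule.mem_bot k, ← h n]
    intro m r hr i x hx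
    by_cases hm : M ≤ m
    · exact hy hr i x hm
    · simp only [OperadData.IsReduced.truncation, if_neg hm] at hx
      rw [(Submodule.mem_bot k).1 hx, map_zero, LinearMap.zero_apply]

/-- Besides i there are two positions to exchange. Fixing i keeps the composition position and the
sign of the outer block permutation. -/
theorem exists_odd_fixing {m : ℕ} (hm : 3 ≤ m) (i : Fin m) :
    ∃ φ : Equiv.Perm (Fin m), φ i = i ∧ sign φ = -1 := by
  obtain ⟨a, b, ha, hb, hab⟩ : ∃ a b : Fin m, i ≠ a ∧ i ≠ b ∧ a ≠ b := by
    rcases i with ⟨_ | _ | i, hi⟩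
    · exact ⟨⟨1, by omega⟩, ⟨2, by omega⟩, by simp, by simp, by simp⟩
    · exact ⟨⟨0, by omega⟩, ⟨2, by omega⟩, by simp, by simp, by simp⟩
    · exact ⟨⟨0, by omega⟩, ⟨1, by omega⟩, by simp, by simp, by simp⟩
  exact ⟨Equiv.swap a b, Equiv.swap_apply_of_ne_of_ne ha hb, sign_swap hab⟩

end SymOperad

/-! ### Odd permutations act by a common sign -/

namespace SymOperad

open Equiv.Perm

variable {k : Type u} [Field k] {P : SymOperad.{u, v} k}

theorem comp_act_eq_of_odd {N : ℕ}
    (htriv : ∀ n, N ≤ n → ∀ x : P.Op n, ∀ σ ∈ alternatingGroup (Fin n), P.act σ x = x)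
    {m n r : ℕ} (hr : N ≤ r) (h : r + 1 = m + n) (i : Fin m) (x : P.Op m) (y : P.Op n)
    {σ : Equiv.Perm (Fin n)} (hσ : sign σ = -1) {ρ : Equiv.Perm (Fin r)} (hρ : sign ρ = -1) :
    P.comp h i x (P.act σ y) = P.act ρ (P.comp h i x y) := by
  rw [P.comp_act]
  exact OperadData.act_eq_of_sign_eq (htriv r hr) (by rw [sign_innerPerm, hσ, hρ]) _

/-- Since x has large arity, σ may be replaced by an odd permutation fixing i, whose block
permutation is again odd. -/
theorem act_comp_eq_of_odd {N : ℕ} (hN : 3 ≤ N)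
    (htriv : ∀ n, N ≤ n → ∀ x : P.Op n, ∀ σ ∈ alternatingGroup (Fin n), P.act σ x = x)
    {m n r : ℕ} (hm : N ≤ m) (hr : N ≤ r) (h : r + 1 = m + n) (i : Fin m) (x : P.Op m)
    (y : P.Op n) {σ : Equiv.Perm (Fin m)} (hσ : sign σ = -1) {ρ : Equiv.Perm (Fin r)}
    (hρ : sign ρ = -1) :
    P.comp h i (P.act σ x) y = P.act ρ (P.comp h i x y) := by
  obtain ⟨φ, hφi, hφ⟩ := exists_odd_fixing (hN.trans hm) i
  rw [OperadData.act_eq_of_sign_eq (htriv m hm) (hσ.trans hφ.symm), P.act_comp, hφi]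
  exact OperadData.act_eq_of_sign_eq (htriv r hr)
    (by rw [sign_outerPerm_of_fixed h i φ hφi, hφ, hρ]) _

/-- The differences `y ∗ σ - c y`, with `σ` odd and `y` of arity `n ≥ N`. -/
def oddDifferences (P : SymOperad.{u, v} k) (N : ℕ) (c : k) (n : ℕ) : Set (P.Op n) :=
  {x | N ≤ n ∧ ∃ (y : P.Op n) (σ : Equiv.Perm (Fin n)), sign σ = -1 ∧ x = P.act σ y - c • y}

/-- The ideal generated by the differences `y ∗ σ - c y`, with `σ` odd and `y` of large arity. -/
def oddDifferenceIdeal (hred : P.IsReduced) {N : ℕ} (hN : 3 ≤ N)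
    (htriv : ∀ n, N ≤ n → ∀ x : P.Op n, ∀ σ ∈ alternatingGroup (Fin n), P.act σ x = x) (c : k) :
    OperadData.OpIdeal P.toOperadData where
  carrier n := Submodule.span k (P.oddDifferences N c n)
  act_mem {n} τ x hx := by
    refine (Submodule.span_le (p := Submodule.comap (P.act τ)
      (Submodule.span k (P.oddDifferences N c n)))).2 ?_ hx
    rintro _ ⟨hn, y, σ, hσ, rfl⟩
    refine Submodule.subset_span ⟨hn, P.act τ y, σ, hσ, ?_⟩
    rw [map_sub, map_smul, ← P.act_mul, ← P.act_mul]
    congr 1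
    -- σ τ and τ σ have the same sign, so the two actions commute in this arity.
    exact OperadData.act_eq_of_sign_eq (htriv n hn) (by rw [Equiv.Perm.sign_mul, Equiv.Perm.sign_mul, mul_comm]) y
  comp_mem_left {m n r} h i x y hx := by
    rcases Nat.eq_zero_or_pos n with rfl | hn
    · rw [@Subsingleton.elim _ hred y 0, map_zero]; exact zero_mem _
    refine (Submodule.span_le (p := Submodule.comap ((P.comp h i).flip y)
      (Submodule.span k (P.oddDifferences N c r)))).2 ?_ hx
    rintro _ ⟨hm, x, σ, hσ, rfl⟩
    obtain ⟨ρ, -, hρ⟩ := exists_odd_fixing (show 3 ≤ r by omega) ⟨0, by omega⟩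
    refine Submodule.subset_span ⟨by omega, P.comp h i x y, ρ, hρ, ?_⟩
    rw [LinearMap.flip_apply, map_sub, map_smul, LinearMap.sub_apply, LinearMap.smul_apply,
      act_comp_eq_of_odd hN htriv hm (by omega) h i x y hσ hρ]
  comp_mem_right {m n r} h i x y hy := by
    refine (Submodule.span_le (p := Submodule.comap (P.comp h i x)
      (Submodule.span k (P.oddDifferences N c r)))).2 ?_ hy
    rintro _ ⟨hn, y, σ, hσ, rfl⟩
    have := i.2
    obtain ⟨ρ, -, hρ⟩ := exists_odd_fixing (show 3 ≤ r by omega) ⟨0, by omega⟩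
    refine Submodule.subset_span ⟨by omega, P.comp h i x y, ρ, hρ, ?_⟩
    rw [map_sub, map_smul, comp_act_eq_of_odd htriv (by omega) h i x y hσ hρ]

theorem act_eq_of_oddDifferenceIdeal_eq_bot (hred : P.IsReduced) {N : ℕ} (hN : 3 ≤ N)
    (htriv : ∀ n, N ≤ n → ∀ x : P.Op n, ∀ σ ∈ alternatingGroup (Fin n), P.act σ x = x) {c : k}
    (h : ∀ n, (oddDifferenceIdeal hred hN htriv c).carrier n = ⊥) {n : ℕ} (hn : N ≤ n)
    {σ : Equiv.Perm (Fin n)} (hσ : sign σ = -1) (x : P.Op n) : P.act σ x = c • x := by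
  rw [← sub_eq_zero, ← Submodule.mem_bot k, ← h n]
  exact Submodule.subset_span ⟨hn, x, σ, hσ, rfl⟩

/-- In a prime almost `A`-trivial operad, the odd permutations act by a common sign. -/
theorem exists_sign_act (hred : P.IsReduced) (hfin : P.IsLocallyFinite)
    (hinf : P.IsInfiniteDimensional) (hprime : P.IsPrime) (htriv : P.IsAlmostATrivial) :
    ∃ χ : ℤˣ →* k, ((∀ u, χ u = 1) ∨ ∀ u, χ u = ((u : ℤ) : k)) ∧
      ∀ (n : ℕ) (σ : Equiv.Perm (Fin n)) (x : P.Op n), P.act σ x = χ (sign σ) • x := by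
  obtain ⟨N₀, hN₀⟩ := htriv
  obtain ⟨N, hN, hNN⟩ : ∃ N, 3 ≤ N ∧ N₀ ≤ N := ⟨max 3 N₀, le_max_left _ _, le_max_right _ _⟩
  have htriv : ∀ n, N ≤ n → ∀ x : P.Op n, ∀ σ ∈ alternatingGroup (Fin n), P.act σ x = x :=
    fun n hn => hN₀ n (hNN.trans hn)
  have key : ∀ {m n r : ℕ} (h : r + 1 = m + n) (i : Fin m) (x : P.Op m) (y : P.Op n),
      x ∈ (oddDifferenceIdeal hred hN htriv 1).carrier m →
      y ∈ (oddDifferenceIdeal hred hN htriv (-1)).carrier n → P.comp h i x y = 0 := by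
    intro m n r h i x y hx hy
    refine Submodule.span_induction₂ (p := fun x y _ _ => P.comp h i x y = 0)
      ?_ ?_ ?_ ?_ ?_ ?_ ?_ hx hy
    · rintro _ _ ⟨hm, x, σ, hσ, rfl⟩ ⟨hn, y, τ, hτ, rfl⟩
      have hr : N ≤ r := by omega
      obtain ⟨ρ, -, hρ⟩ := exists_odd_fixing (hN.trans hr) ⟨0, by omega⟩
      simp only [map_sub, map_smul, LinearMap.sub_apply, LinearMap.smul_apply,
        act_comp_eq_of_odd hN htriv hm hr h i _ _ hσ hρ,
        comp_act_eq_of_odd htriv hr h i _ _ hτ hρ]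
      -- Expanding (ρ-1)(ρ+1) leaves ρ²-1, and ρ² is even.
      rw [← P.act_mul, htriv r hr _ (ρ * ρ) (by
        rw [mem_alternatingGroup, Equiv.Perm.sign_mul]; exact Int.units_mul_self _)]
      simp
    · intro y _; rw [map_zero, LinearMap.zero_apply]
    · intro x _; rw [map_zero]
    · intro x y z _ _ _ h1 h2; rw [map_add, LinearMap.add_apply, h1, h2, add_zero]
    · intro x y z _ _ _ h1 h2; rw [map_add, h1, h2, add_zero]
    · intro c x y _ _ h1; rw [map_smul, LinearMap.smul_apply, h1, smul_zero]
    · intro c x y _ _ h1; rw [map_smul, h1, smul_zero]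
  have large : ∃ χ : ℤˣ →* k, ((∀ u, χ u = 1) ∨ ∀ u, χ u = ((u : ℤ) : k)) ∧
      ∀ (n : ℕ), N ≤ n → ∀ (σ : Equiv.Perm (Fin n)) (x : P.Op n),
        P.act σ x = χ (sign σ) • x := by
    rcases hprime.eq_bot_or_eq_bot _ _ key with h | h
    · refine ⟨1, Or.inl fun _ => rfl, fun n hn σ x => ?_⟩
      rcases Int.units_eq_one_or (sign σ) with hσ | hσ
      · rw [htriv n hn x σ (mem_alternatingGroup.2 hσ), MonoidHom.one_apply, one_smul]
      · rw [act_eq_of_oddDifferenceIdeal_eq_bot hred hN htriv h hn hσ, MonoidHom.one_apply]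
    · refine ⟨(Int.castRingHom k : ℤ →* k).comp (Units.coeHom ℤ), Or.inr fun _ => rfl,
        fun n hn σ x => ?_⟩
      rcases Int.units_eq_one_or (sign σ) with hσ | hσ
      · rw [htriv n hn x σ (mem_alternatingGroup.2 hσ), hσ, map_one, one_smul]
      · rw [act_eq_of_oddDifferenceIdeal_eq_bot hred hN htriv h hn hσ, hσ]
        simp
  obtain ⟨χ, hχ, hact⟩ := large
  refine ⟨χ, hχ, fun n σ x => ?_⟩
  rw [← sub_eq_zero]
  -- Composing under an operation of large arity moves the action to large arity without changing
  -- the sign.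
  refine eq_zero_of_comp_eq_zero hred hfin hinf hprime N _ fun {m r} h i a hm => ?_
  rcases Nat.eq_zero_or_pos n with rfl | hn
  · rw [@Subsingleton.elim _ hred (_ - _) 0, map_zero]
  · rw [map_sub, map_smul, P.comp_act, hact r (by omega), sign_innerPerm, sub_self]

/-! ### Moving positions, commutativity up to sign, and squares -/

section Character

variable {χ : ℤˣ →* k}

theorem character_neg_one_mul_self (χ : ℤˣ →* k) : χ (-1) * χ (-1) = 1 := by
  rw [← map_mul, neg_one_mul, neg_neg, map_one]

/-- Equivariance under an adjacent transposition contributes χ(-1) on x and χ(-1)^n on the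
composite, hence χ(-1)^(n+1) per step. -/
theorem comp_eq_pow_smul_comp_zero
    (hact : ∀ (n : ℕ) (σ : Equiv.Perm (Fin n)) (x : P.Op n), P.act σ x = χ (sign σ) • x)
    {m n r : ℕ} (h : r + 1 = m + n) (x : P.Op m) (y : P.Op n) (i₀ : Fin m) (hi₀ : (i₀ : ℕ) = 0)
    (i : Fin m) :
    P.comp h i x y = χ (-1) ^ ((n + 1) * (i : ℕ)) • P.comp h i₀ x y := by
  obtain ⟨i, hi⟩ := i
  induction i with
  | zero => rw [show i₀ = ⟨0, hi⟩ from Fin.ext hi₀, mul_zero, pow_zero, one_smul]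
  | succ i ih =>
    have hlt : i < m := by omega
    have h1 := P.act_comp h ⟨i, hlt⟩ (Equiv.swap ⟨i, hlt⟩ ⟨i + 1, hi⟩) x y
    rw [hact, hact, sign_outerPerm_swap h _ _ rfl, sign_swap (by simp), Equiv.swap_apply_left,
      map_smul, LinearMap.smul_apply, map_pow] at h1
    have h2 : χ (-1) ^ n * χ (-1) ^ n = 1 := by
      rw [← mul_pow, character_neg_one_mul_self, one_pow]
    calc P.comp h ⟨i + 1, hi⟩ x y
        = χ (-1) ^ n • χ (-1) ^ n • P.comp h ⟨i + 1, hi⟩ x y := by rw [smul_smul, h2, one_smul]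
      _ = _ := by
        rw [← h1, ih hlt, smul_smul, smul_smul]
        congr 1
        dsimp only
        ring

/-- Plugging y and z into two different inputs of an x can be done in either order; moving each
composition to the first input turns this into x ∘ (y ∘ z) = ± x ∘ (z ∘ y), and x cancels by
primality. -/
theorem comp_zero_comm
    (hred : P.IsReduced) (hfin : P.IsLocallyFinite)
    (hinf : P.IsInfiniteDimensional) (hprime : P.IsPrime)
    (hact : ∀ (n : ℕ) (σ : Equiv.Perm (Fin n)) (x : P.Op n), P.act σ x = χ (sign σ) • x)
    {n p r : ℕ} (h : r + 1 = n + p) (h' : r + 1 = p + n) (y : P.Op n) (z : P.Op p)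
    (i : Fin n) (hi : (i : ℕ) = 0) (j : Fin p) (hj : (j : ℕ) = 0) :
    P.comp h i y z = χ (-1) ^ ((n + 1) * (p + 1)) • P.comp h' j z y := by
  rw [← sub_eq_zero]
  -- Arity at least 2 provides the two inputs of x needed for parallel composition.
  refine eq_zero_of_comp_eq_zero hred hfin hinf hprime 2 _ fun {m s} hs q x hm => ?_
  rw [comp_eq_pow_smul_comp_zero hact hs x _ ⟨0, by omega⟩ rfl q, map_sub, map_smul]
  have hip := i.2
  have hjp := j.2
  have ha : m + n - 1 + 1 = m + n := by omega
  have hb : m + p - 1 + 1 = m + p := by omega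
  have hsa : s + 1 = (m + n - 1) + p := by omega
  have hsb : s + 1 = (m + p - 1) + n := by omega
  have e1 := P.comp_assoc ha hsa h hs ⟨0, by omega⟩ i ⟨0, by omega⟩ (by simp [hi]) x y z
  have e2 := P.comp_assoc hb hsb h' hs ⟨0, by omega⟩ j ⟨0, by omega⟩ (by simp [hj]) x z y
  have e3 := P.comp_comm ha hsa hb hsb ⟨0, by omega⟩ ⟨1, by omega⟩ ⟨n, by omega⟩ ⟨0, by omega⟩
    (by simp [Fin.lt_def]) (by simp; omega) rfl x y z
  rw [comp_eq_pow_smul_comp_zero hact hsa _ z ⟨0, by omega⟩ rfl,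
    comp_eq_pow_smul_comp_zero hact hb x z ⟨0, by omega⟩ rfl, map_smul, LinearMap.smul_apply,
    e1, e2] at e3
  dsimp only at e3
  have h2 : χ (-1) ^ ((p + 1) * n) * χ (-1) ^ ((p + 1) * n) = 1 := by
    rw [← mul_pow, character_neg_one_mul_self, one_pow]
  have e4 : P.comp hs ⟨0, by omega⟩ x (P.comp h i y z) =
      χ (-1) ^ ((n + 1) * (p + 1)) • P.comp hs ⟨0, by omega⟩ x (P.comp h' j z y) := by
    calc P.comp hs ⟨0, by omega⟩ x (P.comp h i y z)
        = χ (-1) ^ ((p + 1) * n) • χ (-1) ^ ((p + 1) * n) •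
            P.comp hs ⟨0, by omega⟩ x (P.comp h i y z) := by rw [smul_smul, h2, one_smul]
      _ = _ := by
        rw [e3, smul_smul]
        congr 1
        ring
  rw [e4, sub_self, smul_zero]

/-- The position i may miss the block of z, so both compositions are first moved to the first input,
where associativity gives a ∘ (z ∘ y) up to sign. -/
theorem comp_comp_eq_zero (hred : P.IsReduced)
    (hact : ∀ (n : ℕ) (σ : Equiv.Perm (Fin n)) (x : P.Op n), P.act σ x = χ (sign σ) • x)
    {n : ℕ} {y : P.Op n} {p : ℕ} {z : P.Op p}
    (hz : ∀ (r : ℕ) (h : r + 1 = p + n) (i : Fin p), P.comp h i z y = 0)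
    {m q s : ℕ} (h : q + 1 = m + p) (j : Fin m) (a : P.Op m) (hs : s + 1 = q + n) (i : Fin q) :
    P.comp hs i (P.comp h j a z) y = 0 := by
  rcases Nat.eq_zero_or_pos p with rfl | hp
  · rw [@Subsingleton.elim _ hred z 0, map_zero, map_zero, LinearMap.zero_apply]
  · have := j.2
    have := i.2
    rw [comp_eq_pow_smul_comp_zero hact hs _ y ⟨0, by omega⟩ rfl,
      comp_eq_pow_smul_comp_zero hact h a z ⟨0, by omega⟩ rfl, map_smul, LinearMap.smul_apply,
      P.comp_assoc h hs (b := p + n - 1) (by omega) (by omega) ⟨0, by omega⟩ ⟨0, hp⟩ _ rfl, hz,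
      map_zero, smul_zero, smul_zero]

/-- The operations `z` with `z ∘ᵢ y = 0` for all `i`. -/
def leftAnnihilator (hred : P.IsReduced) (hfin : P.IsLocallyFinite)
    (hinf : P.IsInfiniteDimensional) (hprime : P.IsPrime)
    (hact : ∀ (n : ℕ) (σ : Equiv.Perm (Fin n)) (x : P.Op n), P.act σ x = χ (sign σ) • x)
    {n : ℕ} (y : P.Op n) : OperadData.OpIdeal P.toOperadData where
  carrier p :=
    { carrier := {z | ∀ (r : ℕ) (h : r + 1 = p + n) (i : Fin p), P.comp h i z y = 0}
      add_mem' := fun {a b} ha hb r h i => by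
        rw [map_add, LinearMap.add_apply, ha r h i, hb r h i, add_zero]
      zero_mem' := fun r h i => by rw [map_zero, LinearMap.zero_apply]
      smul_mem' := fun c a ha r h i => by
        rw [map_smul, LinearMap.smul_apply, ha r h i, smul_zero] }
  act_mem σ z hz r h i := by
    rw [hact, map_smul, LinearMap.smul_apply, hz r h i, smul_zero]
  comp_mem_left {p b q} h j z a hz s hs i := by
    have := j.2
    rcases Nat.eq_zero_or_pos b with rfl | hb
    · rw [@Subsingleton.elim _ hred a 0, map_zero, map_zero, LinearMap.zero_apply]
    -- Commutativity up to sign replaces z ∘ a by a ∘ z, reducing to the other side.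
    · rw [comp_eq_pow_smul_comp_zero hact h z a ⟨0, by omega⟩ rfl,
        comp_zero_comm hred hfin hinf hprime hact h (by omega) z a _ rfl ⟨0, hb⟩ rfl,
        map_smul, map_smul, LinearMap.smul_apply, LinearMap.smul_apply,
        comp_comp_eq_zero hred hact hz, smul_zero, smul_zero]
  comp_mem_right h j a z hz _ hs i := comp_comp_eq_zero hred hact hz h j a hs i

/-- An operation of square zero is zero. -/
theorem eq_zero_of_comp_self_eq_zero
    (hred : P.IsReduced) (hfin : P.IsLocallyFinite)
    (hinf : P.IsInfiniteDimensional) (hprime : P.IsPrime)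
    (hact : ∀ (n : ℕ) (σ : Equiv.Perm (Fin n)) (x : P.Op n), P.act σ x = χ (sign σ) • x)
    {n : ℕ} (y : P.Op n)
    (hy : ∀ (r : ℕ) (h : r + 1 = n + n) (i : Fin n), P.comp h i y y = 0) : y = 0 := by
  -- Since y squares to zero it lies in its own left annihilator; it also lies in the right
  -- annihilator of that ideal. One of the two ideals is zero.
  rcases eq_bot_or_rightAnnihilator_eq_bot hprime
    (leftAnnihilator hred hfin hinf hprime hact y) with h | h
  · rw [← Submodule.mem_bot k, ← h n]
    exact hy
  · rw [← Submodule.mem_bot k, ← h n]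
    exact fun m r hr i x hx => hx r hr i

end Character

/-- In an infinite dimensional prime almost `A`-trivial operad, partial compositions do not depend
on the position and are commutative. The symmetric groups act trivially, or by the sign, in which
case all operations have odd arity. -/
theorem act_and_comp_of_isPrime (hred : P.IsReduced) (hfin : P.IsLocallyFinite)
    (hinf : P.IsInfiniteDimensional) (hprime : P.IsPrime) (htriv : P.IsAlmostATrivial) :
    ((∀ (n : ℕ) (σ : Equiv.Perm (Fin n)) (x : P.Op n), P.act σ x = x) ∨
      (∀ (n : ℕ) (σ : Equiv.Perm (Fin n)) (x : P.Op n), P.act σ x = ((sign σ : ℤ) : k) • x) ∧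
        ∀ n, Even n → Subsingleton (P.Op n)) ∧
    ∀ (m : ℕ) (μ : P.Op m), P.IsCentral μ := by
  obtain ⟨χ, hχ, hact⟩ := exists_sign_act hred hfin hinf hprime htriv
  have hcases : (∀ u, χ u = 1) ∨
      (∀ u, χ u = ((u : ℤ) : k)) ∧ ∀ n, Even n → ∀ x : P.Op n, x = 0 := by
    rcases hχ with h | h
    · exact Or.inl h
    have hneg : χ (-1) = -1 := by rw [h]; simp
    -- In characteristic 2 the sign action is trivial. Otherwise y ∘₁ y = -(y ∘₁ y) in even arity
    -- forces y ∘₁ y = 0.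
    by_cases h2 : (2 : k) = 0
    · left
      intro u
      rcases Int.units_eq_one_or u with rfl | rfl
      · exact map_one χ
      · rw [hneg]; linear_combination -h2
    · refine Or.inr ⟨h, fun n hn y => ?_⟩
      refine eq_zero_of_comp_self_eq_zero hred hfin hinf hprime hact y fun r hr i => ?_
      rw [comp_eq_pow_smul_comp_zero hact hr y y ⟨0, i.pos⟩ rfl]
      have h3 := comp_zero_comm hred hfin hinf hprime hact hr hr y y ⟨0, i.pos⟩ rfl
        ⟨0, i.pos⟩ rfl
      rw [hneg, (hn.add_one.mul hn.add_one).neg_one_pow, neg_one_smul, eq_neg_iff_add_eq_zero,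
        ← two_smul k] at h3
      rw [(smul_eq_zero.1 h3).resolve_left h2, smul_zero]
  constructor
  · rcases hcases with h | ⟨h, h'⟩
    · exact Or.inl fun n σ x => by rw [hact, h, one_smul]
    · exact Or.inr ⟨fun n σ x => by rw [hact, h], fun n hn =>
        ⟨fun x y => (h' n hn x).trans (h' n hn y).symm⟩⟩
  · intro m μ n r hr hr' ν i j
    have hpow : (∀ e, χ (-1) ^ ((n + 1) * e) = 1) ∧ (∀ e, χ (-1) ^ ((m + 1) * e) = 1) ∨
        P.comp hr ⟨0, i.pos⟩ μ ν = 0 ∧ P.comp hr' ⟨0, j.pos⟩ ν μ = 0 := by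
      rcases hcases with h | ⟨h, h'⟩
      · left; simp [h]
      · have hneg : χ (-1) = -1 := by rw [h]; simp
        by_cases hm : Even m
        · right; rw [h' m hm μ]; simp
        by_cases hn : Even n
        · right; rw [h' n hn ν]; simp
        left
        rw [Nat.not_even_iff_odd] at hm hn
        simp [hneg, pow_mul, hm.add_one.neg_one_pow, hn.add_one.neg_one_pow]
    rw [comp_eq_pow_smul_comp_zero hact hr μ ν ⟨0, i.pos⟩ rfl i,
      comp_eq_pow_smul_comp_zero hact hr' ν μ ⟨0, j.pos⟩ rfl j]
    rcases hpow with ⟨h1, h2⟩ | ⟨h1, h2⟩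
    · rw [h1, h2, one_smul, one_smul,
        comp_zero_comm hred hfin hinf hprime hact hr hr' μ ν _ rfl ⟨0, j.pos⟩ rfl, h2, one_smul]
    · rw [h1, h2, smul_zero, smul_zero]

end SymOperad

/-! ### The graded algebra of operations -/

noncomputable section

namespace SymOperad

open Equiv.Perm

variable {k : Type u} [Field k] (P : SymOperad.{u, v} k)

/-- The operations of arity `n + 1`, seen in degree `n`. -/
abbrev Shifted (n : ℕ) : Type v := P.Op (n + 1)

theorem comp_sigma_eq {m n m' n' r r' : ℕ} (h : r + 1 + 1 = m + n) (h' : r' + 1 + 1 = m' + n')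
    (i : Fin m) (i' : Fin m') (x : P.Op m) (y : P.Op n) (x' : P.Op m') (y' : P.Op n')
    (hr : r = r')
    (hxy : ∀ h'' : r' + 1 + 1 = m + n, P.comp h'' i x y = P.comp h' i' x' y') :
    (⟨r, P.comp h i x y⟩ : GradedMonoid P.Shifted) = ⟨r', P.comp h' i' x' y'⟩ := by
  subst hr
  rw [hxy]

/-- Composition in the first input is associative and unital in any operad; shifting arity by one
makes degrees additive. -/
instance gMul : GradedMonoid.GMul P.Shifted where
  mul {i j} x y := P.comp (r := i + j + 1) (by omega) 0 x y

instance gOne : GradedMonoid.GOne P.Shifted where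
  one := P.one

theorem mk_smul_one_mul (c : k) (i : ℕ) (x : P.Op (i + 1)) :
    (GradedMonoid.mk (A := P.Shifted) 0 (c • P.one) * GradedMonoid.mk (A := P.Shifted) i x) =
      GradedMonoid.mk (A := P.Shifted) i (c • x) :=
  (P.comp_sigma_eq _ (Nat.add_comm (i + 1) 1) _ 0 _ _ P.one (c • x) (zero_add i) fun h'' =>
    (LinearMap.congr_fun (map_smul (P.comp h'' 0) c P.one) x).trans
      (map_smul (P.comp _ 0 P.one) c x).symm).trans
    (congrArg (Sigma.mk i) (P.one_comp (c • x)))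

theorem mk_mul_smul_one (c : k) (i : ℕ) (x : P.Op (i + 1)) :
    (GradedMonoid.mk (A := P.Shifted) i x * GradedMonoid.mk (A := P.Shifted) 0 (c • P.one)) =
      GradedMonoid.mk (A := P.Shifted) i (c • x) :=
  congrArg (Sigma.mk i) ((map_smul _ _ _).trans (congrArg (c • ·) (P.comp_one 0 x)))

instance gMonoid : GradedMonoid.GMonoid P.Shifted where
  one_mul := by
    rintro ⟨i, a⟩
    have := P.mk_smul_one_mul 1 i a
    rwa [one_smul, one_smul] at this
  mul_one := by
    rintro ⟨i, a⟩
    exact congrArg (Sigma.mk i) (P.comp_one 0 a)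
  mul_assoc := by
    rintro ⟨i, a⟩ ⟨j, b⟩ ⟨l, c⟩
    refine P.comp_sigma_eq _ _ _ _ _ _ _ _ (add_assoc i j l) fun h'' => ?_
    exact P.comp_assoc _ _ _ _ 0 0 0 rfl a b c

instance gRing : DirectSum.GRing P.Shifted where
  __ := P.gMonoid
  mul_zero _ := map_zero _
  zero_mul b := LinearMap.congr_fun (map_zero (P.comp _ 0)) b
  mul_add _ _ _ := map_add _ _ _
  add_mul a b c := LinearMap.congr_fun (map_add (P.comp _ 0) a b) c
  natCast n := n • P.one
  natCast_zero := zero_smul _ _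
  natCast_succ _ := succ_nsmul _ _
  intCast n := n • P.one
  intCast_ofNat _ := natCast_zsmul _ _
  intCast_negSucc_ofNat _ := negSucc_zsmul _ _

instance gAlgebra : DirectSum.GAlgebra k P.Shifted where
  toFun := (LinearMap.toSpanSingleton k (P.Op 1) P.one).toAddMonoidHom
  map_one := one_smul _ _
  map_mul r s := by
    refine ((P.mk_mul_smul_one s 0 (r • P.one)).trans ?_).symm
    exact congrArg (Sigma.mk 0) (by rw [smul_smul, mul_comm]; rfl)
  commutes := by
    rintro r ⟨i, x⟩
    exact (P.mk_smul_one_mul r i x).trans (P.mk_mul_smul_one r i x).symm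
  smul_def := by
    rintro r ⟨i, x⟩
    exact (P.mk_smul_one_mul r i x).symm

/-- The degree `i` part of the algebra of all operations. -/
def gradedPart (i : ℕ) : Submodule k (⨁ n, P.Shifted n) :=
  LinearMap.range (DirectSum.lof k ℕ P.Shifted i)

/-- Operations of arity `i + 1` are the elements of degree `i`. -/
def gradedPartEquiv (i : ℕ) : P.Op (i + 1) ≃ₗ[k] P.gradedPart i :=
  LinearEquiv.ofInjective (DirectSum.lof k ℕ P.Shifted i) (DirectSum.of_injective i)

instance gradedAlgebra_gradedPart : GradedAlgebra P.gradedPart where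
  one_mem := ⟨P.one, rfl⟩
  mul_mem := by
    rintro i j _ _ ⟨x, rfl⟩ ⟨y, rfl⟩
    exact ⟨GradedMonoid.GMul.mul x y, (DirectSum.of_mul_of x y).symm⟩
  toDecomposition := DirectSum.Decomposition.ofLinearMap _
    (DirectSum.toModule k ℕ _ fun i =>
      DirectSum.lof k ℕ (fun i => P.gradedPart i) i ∘ₗ (P.gradedPartEquiv i).toLinearMap)
    (by
      refine DirectSum.linearMap_ext k fun i => LinearMap.ext fun x => ?_
      simp only [LinearMap.comp_apply, DirectSum.toModule_lof, LinearEquiv.coe_coe,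
        DirectSum.coeLinearMap_lof, LinearMap.id_apply]
      rfl)
    (by
      refine DirectSum.linearMap_ext k fun i => LinearMap.ext fun x => ?_
      obtain ⟨x, rfl⟩ := (P.gradedPartEquiv i).surjective x
      simp only [LinearMap.comp_apply, DirectSum.coeLinearMap_lof, LinearMap.id_apply]
      change DirectSum.toModule k ℕ _ _ (DirectSum.lof k ℕ P.Shifted i x) = _
      rw [DirectSum.toModule_lof]
      rfl)

end SymOperad

end

/-! ### PGC algebras of a single type -/

noncomputable section

namespace TypedGradedAlgebra

variable {k : Type u} [Field k] {A : TypedGradedAlgebra.{u, v} k}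

theorem twist_of_even_eq_top {i : ℕ} (h : A.even i = ⊤) (c : k) (x : A.grading i) :
    A.twist c i x = x := by
  have hx : x ∈ A.even i := h ▸ Submodule.mem_top
  rw [twist, LinearMap.add_apply, LinearMap.smul_apply,
    Submodule.projection_apply_of_mem_left _ hx,
    (Submodule.projection_apply_eq_zero_iff (A.isCompl i).symm).2 hx, smul_zero, add_zero]

theorem twist_of_odd_eq_top {i : ℕ} (h : A.odd i = ⊤) (c : k) (x : A.grading i) :
    A.twist c i x = c • x := by
  have hx : x ∈ A.odd i := h ▸ Submodule.mem_top
  rw [twist, LinearMap.add_apply, LinearMap.smul_apply,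
    Submodule.projection_apply_of_mem_left _ hx,
    (Submodule.projection_apply_eq_zero_iff (A.isCompl i)).2 hx, zero_add]

theorem mul_mem_iSup_grading (a x : A.carrier)
    (hx : x ∈ ⨆ (i : ℕ) (_ : 1 ≤ i), A.grading i) :
    a * x ∈ ⨆ (i : ℕ) (_ : 1 ≤ i), A.grading i := by
  refine (iSup₂_le (a := Submodule.comap (LinearMap.mulLeft k a)
    (⨆ (i : ℕ) (_ : 1 ≤ i), A.grading i)) fun i hi x hx => ?_ :
      ⨆ (i : ℕ) (_ : 1 ≤ i), A.grading i ≤ _) hx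
  rw [Submodule.mem_comap, LinearMap.mulLeft_apply]
  induction a using DirectSum.Decomposition.inductionOn A.grading with
  | zero => rw [zero_mul]; exact zero_mem _
  | @homogeneous j a =>
    exact (le_iSup₂ (f := fun (i : ℕ) (_ : 1 ≤ i) => A.grading i) (j + i) (by omega))
      (SetLike.mul_mem_graded a.2 hx)
  | add a b ha hb => rw [add_mul]; exact add_mem ha hb

/-- A commutative algebra in which all elements of positive degree have the same type is PGC as
soon as there are no odd elements of odd degree. -/
theorem IsCommutative.isPGC (hc : A.IsCommutative) (t₀ : Fin 2)
    (htop : ∀ i, 1 ≤ i → A.part i t₀ = ⊤)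
    (hbot : ∀ i, 1 ≤ i → ∀ t, t ≠ t₀ → A.part i t = ⊥)
    (hodd : ∀ i, Odd i → A.odd i = ⊥) : A.IsPGC := by
  have hleft : ∀ (t : Fin 2) (a x : A.carrier),
      x ∈ A.positivePart t → a * x ∈ A.positivePart t := by
    intro t a x hx
    by_cases ht : t = t₀
    · have : A.positivePart t = ⨆ (i : ℕ) (_ : 1 ≤ i), A.grading i := by
        refine iSup_congr fun i => iSup_congr fun hi => ?_
        rw [ht, htop i hi, Submodule.map_top, Submodule.range_subtype]
      rw [this] at hx ⊢
      exact mul_mem_iSup_grading a x hx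
    · have : A.positivePart t = ⊥ := by
        refine iSup₂_eq_bot.2 fun i hi => ?_
        rw [hbot i hi t ht, Submodule.map_bot]
      rw [this] at hx ⊢
      rw [(Submodule.mem_bot k).1 hx, mul_zero]
      exact zero_mem _
  refine ⟨hleft, fun t a x hx => hc a x ▸ hleft t a x hx, fun i j s t y z hy _ => ?_⟩
  by_cases he : Even (i * j * (s : ℕ) * (t : ℕ))
  · rw [he.neg_one_pow, one_mul, hc]
  · simp only [Nat.not_even_iff_odd, Nat.odd_mul] at he
    -- A sign can occur only for y odd of odd degree, and such y is zero.
    obtain ⟨⟨⟨hi, -⟩, hs⟩, -⟩ := he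
    have hs0 : s ≠ 0 := by rintro rfl; simp at hs
    rw [part, if_neg hs0, hodd i hi, Submodule.mem_bot] at hy
    simp [hy]

theorem opComp_of_even (h : ∀ i, A.even i = ⊤) {m n r : ℕ} (hr : m + n = r) (i : Fin (m + 1))
    (x : A.grading m) (y : A.grading n) : A.opComp hr i x y = A.gmul hr x y := by
  rw [opComp]
  split_ifs <;> simp [twist_of_even_eq_top (h _)]

/-- Operations of odd degree vanish, which rules out the special formulas for arity 2 and makes the
remaining exponent n * i even. -/
theorem opComp_of_odd (h : ∀ i, 1 ≤ i → A.odd i = ⊤) (h' : ∀ i, Odd i → Subsingleton (A.grading i))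
    {m n r : ℕ} (hr : m + n = r) (i : Fin (m + 1)) (x : A.grading m) (y : A.grading n) :
    A.opComp hr i x y = A.gmul hr x y := by
  by_cases hn : Odd n
  · have := h' n hn
    rw [Subsingleton.elim y 0, map_zero, map_zero]
  by_cases hm : Odd m
  · have := h' m hm
    rw [Subsingleton.elim x 0, map_zero, map_zero, LinearMap.zero_apply]
  have hm1 : m ≠ 1 := by rintro rfl; exact hm odd_one
  rw [opComp]
  split_ifs with h0
  · rfl
  · rw [LinearMap.comp_apply, twist_of_odd_eq_top (h m (by omega)),
      ((Nat.not_odd_iff_even.1 hn).mul_right _).neg_one_pow, one_smul]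

end TypedGradedAlgebra

/-! ### Comparison of the operad with its algebra -/

namespace SymOperad

open Equiv.Perm

variable {k : Type u} [Field k] (P : SymOperad.{u, v} k)

/-- The algebra of all operations, those of arity at least `2` having the type `t`. -/
def typedAlgebra (hfin : P.IsLocallyFinite) (t : Fin 2) : TypedGradedAlgebra.{u, v} k where
  carrier := ⨁ n, P.Shifted n
  grading := P.gradedPart
  locallyFinite i := by
    have : FiniteDimensional k (P.Op (i + 1)) := hfin (i + 1)
    exact Module.Finite.equiv (P.gradedPartEquiv i)
  even i := if i = 0 ∨ t = 0 then ⊤ else ⊥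
  odd i := if i = 0 ∨ t = 0 then ⊥ else ⊤
  isCompl i := by
    split_ifs
    · exact isCompl_top_bot
    · exact isCompl_bot_top
  even_zero := if_pos (Or.inl rfl)
  odd_zero := if_pos (Or.inl rfl)

variable {P} (hfin : P.IsLocallyFinite)

/-- Both sides equal y ∘ⱼ x; the argument j witnesses that y has an input. -/
theorem comp_eq_comp (hcen : ∀ (m : ℕ) (μ : P.Op m), P.IsCentral μ) {m n r : ℕ}
    (h : r + 1 = m + n) (i i' : Fin m) (j : Fin n) (x : P.Op m) (y : P.Op n) :
    P.comp h i x y = P.comp h i' x y :=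
  (hcen m x h (h.trans (Nat.add_comm m n)) y i j).trans
    (hcen m x h (h.trans (Nat.add_comm m n)) y i' j).symm

theorem typedAlgebra_isCommutative (hcen : ∀ (m : ℕ) (μ : P.Op m), P.IsCentral μ) (t : Fin 2) :
    (P.typedAlgebra hfin t).IsCommutative := by
  intro (a : ⨁ n, P.Shifted n) (b : ⨁ n, P.Shifted n)
  change a * b = b * a
  induction a using DirectSum.induction_on with
  | zero => rw [zero_mul, mul_zero]
  | add a a' ha ha' => rw [add_mul, mul_add, ha, ha']
  | of i x =>
    induction b using DirectSum.induction_on with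
    | zero => rw [zero_mul, mul_zero]
    | add b b' hb hb' => rw [add_mul, mul_add, hb, hb']
    | of j y =>
      rw [DirectSum.of_mul_of, DirectSum.of_mul_of]
      refine DirectSum.of_eq_of_gradedMonoid_eq
        (P.comp_sigma_eq _ _ _ _ _ _ _ _ (add_comm i j) fun h'' => ?_)
      exact hcen _ x _ _ y 0 0

theorem typedAlgebra_isPGC (hcen : ∀ (m : ℕ) (μ : P.Op m), P.IsCentral μ) (t : Fin 2)
    (hodd : t ≠ 0 → ∀ n, Even n → Subsingleton (P.Op n)) : (P.typedAlgebra hfin t).IsPGC := by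
  refine (typedAlgebra_isCommutative hfin hcen t).isPGC t (fun i hi => ?_) (fun i hi s hs => ?_)
    (fun i hi => ?_)
  · by_cases ht : t = 0
    · exact (if_pos ht).trans (if_pos (Or.inr ht))
    · exact (if_neg ht).trans (if_neg (by omega))
  · by_cases ht : t = 0
    · exact (if_neg (ht ▸ hs)).trans (if_pos (Or.inr ht))
    · exact (if_pos (by omega)).trans (if_neg (by omega))
  · by_cases ht : t = 0
    · exact if_pos (Or.inr ht)
    · have := hodd ht (i + 1) hi.add_one
      have : Subsingleton (P.gradedPart i) := (P.gradedPartEquiv i).symm.injective.subsingleton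
      exact eq_bot_iff.2 fun x _ => (Submodule.mem_bot k).2 (this.elim x 0)

theorem typedAlgebra_opComp (t : Fin 2)
    (hodd : t ≠ 0 → ∀ n, Even n → Subsingleton (P.Op n)) {m n r : ℕ} (hr : m + n = r)
    (i : Fin (m + 1)) (x : P.gradedPart m) (y : P.gradedPart n) :
    (P.typedAlgebra hfin t).opComp hr i x y = (P.typedAlgebra hfin t).gmul hr x y := by
  by_cases ht : t = 0
  · exact TypedGradedAlgebra.opComp_of_even (A := P.typedAlgebra hfin t) (fun i => if_pos (Or.inr ht)) hr i x y
  · refine TypedGradedAlgebra.opComp_of_odd (A := P.typedAlgebra hfin t) (fun i hi => if_neg (by omega)) (fun i hi => ?_) hr i x y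
    have := hodd ht (i + 1) hi.add_one
    exact (P.gradedPartEquiv i).symm.injective.subsingleton

theorem gradedPartEquiv_comp (hcen : ∀ (m : ℕ) (μ : P.Op m), P.IsCentral μ) (t : Fin 2)
    {m n r : ℕ} (hr : m + n = r) (h : r + 1 + 1 = (m + 1) + (n + 1)) (i : Fin (m + 1))
    (x : P.Op (m + 1)) (y : P.Op (n + 1)) :
    P.gradedPartEquiv r (P.comp h i x y) =
      (P.typedAlgebra hfin t).gmul hr (P.gradedPartEquiv m x) (P.gradedPartEquiv n y) := by
  subst hr
  refine Subtype.ext ?_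
  rw [comp_eq_comp hcen h i 0 0]
  exact (DirectSum.of_mul_of (A := P.Shifted) x y).symm

/-- The identification of the operad `P` with the operad of its algebra of operations. -/
def isoTypedAlgebra (hred : P.IsReduced) (hcen : ∀ (m : ℕ) (μ : P.Op m), P.IsCentral μ) (t : Fin 2)
    (hodd : t ≠ 0 → ∀ n, Even n → Subsingleton (P.Op n))
    (hact : ∀ (n : ℕ) (σ : Equiv.Perm (Fin n)) (x : P.Op n),
      P.act σ x = if t = 0 then x else ((sign σ : ℤ) : k) • x) :
    OperadData.Iso P.toOperadData (P.typedAlgebra hfin t).toOperad where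
  map n := match n with
    | 0 =>
      have : Subsingleton (P.Op 0) := hred
      have : Subsingleton ((P.typedAlgebra hfin t).opSpace 0) :=
        inferInstanceAs (Subsingleton (⊥ : Submodule k _))
      LinearEquiv.ofSubsingleton (P.Op 0) ((P.typedAlgebra hfin t).opSpace 0)
    | n + 1 => P.gradedPartEquiv n
  map_act {n} σ x := by
    match n, σ, x with
    | 0, σ, x =>
      have : Subsingleton ((P.typedAlgebra hfin t).opSpace 0) :=
        inferInstanceAs (Subsingleton (⊥ : Submodule k _))
      exact this.elim _ _
    | n + 1, σ, x =>
      change P.gradedPartEquiv n (P.act σ x) =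
        (P.typedAlgebra hfin t).twist ((sign σ : ℤ) : k) n (P.gradedPartEquiv n x)
      by_cases ht : n = 0 ∨ t = 0
      · refine Eq.trans ?_ (TypedGradedAlgebra.twist_of_even_eq_top (A := P.typedAlgebra hfin t) (if_pos ht) _ _).symm
        congr 1
        rw [hact]
        -- In arity 1 the symmetric group is trivial, consistent with degree 0 being even whatever t
        -- is.
        rcases ht with rfl | ht
        · have : Subsingleton (Fin (0 + 1)) := Fin.subsingleton_one
          rw [Subsingleton.elim σ 1]
          simp
        · rw [if_pos ht]
      · refine Eq.trans ?_ (TypedGradedAlgebra.twist_of_odd_eq_top (A := P.typedAlgebra hfin t) (if_neg ht) _ _).symm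
        rw [hact, if_neg fun h => ht (Or.inr h), map_smul]
        rfl
  map_one := rfl
  map_comp {m n r} h i x y := by
    match m, n, r, h, i, x, y with
    | 0, _, _, _, i, _, _ => exact i.elim0
    | m + 1, 0, r, h, i, x, y =>
      rw [@Subsingleton.elim _ hred y 0, map_zero, map_zero]
      rfl
    | m + 1, n + 1, 0, h, _, _, _ => omega
    | m + 1, n + 1, r + 1, h, i, x, y =>
      exact (gradedPartEquiv_comp hfin hcen t (by omega) h i x y).trans
        (typedAlgebra_opComp hfin t hodd (by omega) i _ _).symm

end SymOperad

end

theorem corollary5p12 {k : Type u} [Field k] (P : SymOperad.{u, v} k)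
    (hred : P.IsReduced) (hfin : P.IsLocallyFinite) (hinf : P.IsInfiniteDimensional)
    (hprime : P.IsPrime) (htriv : P.IsAlmostATrivial) :
    (∃ A : TypedGradedAlgebra.{u, v} k, A.IsPGC ∧ A.IsCommutative ∧
      Nonempty (OperadData.Iso P.toOperadData A.toOperad)) ∧
    (∀ (m : ℕ) (μ : P.Op m), P.IsCentral μ) := by
  obtain ⟨hact, hcen⟩ := P.act_and_comp_of_isPrime hred hfin hinf hprime htriv
  refine ⟨?_, hcen⟩
  rcases hact with hact | ⟨hact, hodd⟩
  · have hodd : (0 : Fin 2) ≠ 0 → ∀ n, Even n → Subsingleton (P.Op n) := fun h => absurd rfl h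
    exact ⟨P.typedAlgebra hfin 0, SymOperad.typedAlgebra_isPGC hfin hcen 0 hodd,
      SymOperad.typedAlgebra_isCommutative hfin hcen 0,
      ⟨SymOperad.isoTypedAlgebra hfin hred hcen 0 hodd hact⟩⟩
  · exact ⟨P.typedAlgebra hfin 1, SymOperad.typedAlgebra_isPGC hfin hcen 1 fun _ => hodd,
      SymOperad.typedAlgebra_isCommutative hfin hcen 1,
      ⟨SymOperad.isoTypedAlgebra hfin hred hcen 1 (fun _ => hodd) hact⟩⟩
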